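/- Let $N=\{1,\dots,n\}$ be a set of agents and $G$ a finite set of goods. Every agent $i\in N$ has a valuation $v_i:2^G\to\mathbb R$ that is a matroid rank function: $v_i(\emptyset)=0$, $v_i(S\cup\{g\})-v_i(S)\in\{0,1\}$ for all $S\subseteq G$, $g\in G$, and $v_i(S\cup\{g\})-v_i(S)\ge v_i(T\cup\{g\})-v_i(T)$ for all $S\subseteq T\subseteq G$, $g\in G$. An allocation is a partition $X=(X_0,X_1,\dots,X_n)$ of $G$ into possibly empty bundles, where agent $i$ gets $X_i$ and the goods in $X_0$ are unallocated. Let $\pi$ be a permutation of $N$. **Prioritized Lorenz domination.** Let $v'_i(S)=v_i(S)+\pi(i)/n^2$ be the perturbed valuations, and for an allocation $X$ let $s^X_1\le\dots\le s^X_n$ be the numbers $v'_1(X_1),\dots,v'_n(X_n)$ in ascending order. The allocation $X$ is *prioritized Lorenz dominating* with respect to $\pi$ if $\sum_{j=1}^k s^X_j\ge\sum_{j=1}^k s^Y_j$ for all allocations $Y$ and all $k\in\{1,\dots,n\}$. **General Yankee Swap** with a gain function $\phi$, which assigns a real vector $\phi(X,i)$ to an allocation $X$ (through its utility vector $(v_1(X_1),\dots,v_n(X_n))$)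 and an agent $i$. The exchange graph of an allocation $X$ is the directed graph on $G$ with an edge from $g\in X_k$ to $g'\ne g$ whenever $v_k((X_k\setminus\{g\})\cup\{g'\})=v_k(X_k)$, for $k\in\{0,1,\dots,n\}$, where $v_0(S)=|S|$. Let $F_i(X)=\{g\in G: v_i(X_i\cup\{g\})-v_i(X_i)=1\}$. Start with $X=(G,\emptyset,\dots,\emptyset)$ and $U=N$. While $U\neq\emptyset$, let $i$ be the agent of least index among the agents $k\in U$ for which $\phi(X,k)$ is lexicographically maximal. If the exchange graph of $X$ has a path from $F_i(X)$ to $X_0$, take a shortest such path $(g_1,\dots,g_t)$ (any shortest path may be taken), give $g_1$ to $i$, and for $2\le j\le t$ give $g_j$ to the agent who owned $g_{j-1}$ in $X$; otherwise remove $i$ from $U$. When $U=\emptyset$, return $X$. **Theorem.** For all matroid rank valuations $v_1,\dots,v_n$ and every permutation $\pi$, General Yankee Swap with the gain function $\phi(X,i)=(-v_i(X_i),-\pi(i))$ computes a prioritized Lorenz dominating allocation with respect to $\pi$: whatever shortest paths are chosen, the algorithm never gets stuck, terminates after finitely many iterations, and returns an allocation that is prioritized Lorenz dominating with respect to $\pi$.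 -/

import Mathlib

namespace YankeeSwap

/-- Matroid rank functions (binary submodular valuations) on subsets of `G`. -/
structure IsMRF {G : Type*} [DecidableEq G] (f : Finset G → ℝ) : Prop where
  empty : f ∅ = 0
  marginal : ∀ (S : Finset G) (g : G), f (insert g S) - f S = 0 ∨ f (insert g S) - f S = 1
  submodular : ∀ (S T : Finset G) (g : G), S ⊆ T →
    f (insert g T) - f T ≤ f (insert g S) - f S

/-- An allocation: a partition of the goods into the bundles of the `n` agents and a bundle of
unallocated goods. It is given by the owner of each good; `none` means unallocated. -/
abbrev Allocation (n : ℕ) (G : Type*) : Type _ := G → Option (Fin n)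

/-- The bundle owned by `o`; `bundle X none` is the set of unallocated goods. -/
def bundle {n : ℕ} {G : Type*} [Fintype G] (X : Allocation n G) (o : Option (Fin n)) : Finset G :=
  Finset.univ.filter (fun g => X g = o)

/-- The valuations, extended to the dummy agent `none`, who values a bundle at its size. -/
def extVal {n : ℕ} {G : Type*} (v : Fin n → Finset G → ℝ) : Option (Fin n) → Finset G → ℝ
  | none => fun S => (S.card : ℝ)
  | some i => v i

/-- The utility vector of an allocation. -/
def utility {n : ℕ} {G : Type*} [Fintype G] (v : Fin n → Finset G → ℝ) (X : Allocation n G) :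
    Fin n → ℝ :=
  fun i => v i (bundle X (some i))

/-! ### Lorenz domination -/

/-- A vector sorted in ascending order. -/
noncomputable def sortedVec {n : ℕ} (u : Fin n → ℝ) : Fin n → ℝ := u ∘ Tuple.sort u

/-- The sum of the `k` smallest entries of a vector. -/
noncomputable def sumSmallest {n : ℕ} (u : Fin n → ℝ) (k : ℕ) : ℝ :=
  ∑ j ∈ Finset.univ.filter (fun j : Fin n => (j : ℕ) < k), sortedVec u j

/-- `X` is Lorenz dominating with respect to the valuations `v`. -/
def IsLorenzDominating {n : ℕ} {G : Type*} [Fintype G] (v : Fin n → Finset G → ℝ)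
    (X : Allocation n G) : Prop :=
  ∀ (Y : Allocation n G) (k : ℕ), 1 ≤ k → k ≤ n →
    sumSmallest (utility v Y) k ≤ sumSmallest (utility v X) k

/-- The number in `{1, …, n}` that `π` assigns to agent `i` (`Fin n` counts from zero). -/
def priority {n : ℕ} (π : Equiv.Perm (Fin n)) (i : Fin n) : ℝ := ((π i : ℕ) : ℝ) + 1

/-- The perturbed valuations `v'_i(S) = v_i(S) + π(i) / n²`. -/
noncomputable def perturbed {n : ℕ} {G : Type*} (v : Fin n → Finset G → ℝ)
    (π : Equiv.Perm (Fin n)) : Fin n → Finset G → ℝ :=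
  fun i S => v i S + priority π i / (n : ℝ) ^ 2

/-- Prioritized Lorenz dominating allocations with respect to the priority `π`. -/
def IsPrioritizedLorenzDominating {n : ℕ} {G : Type*} [Fintype G] (v : Fin n → Finset G → ℝ)
    (π : Equiv.Perm (Fin n)) (X : Allocation n G) : Prop :=
  IsLorenzDominating (perturbed v π) X

/-! ### The exchange graph and transfers along paths -/

/-- There is an edge of the exchange graph of `X` from `g` to another good `g'` if the owner of `g`
can replace `g` by `g'` without changing the value of their bundle. -/
def ExchangeEdge {n : ℕ} {G : Type*} [Fintype G] [DecidableEq G] (v : Fin n → Finset G → ℝ)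
    (X : Allocation n G) (g g' : G) : Prop :=
  g ≠ g' ∧
    extVal v (X g) (insert g' ((bundle X (X g)).erase g)) = extVal v (X g) (bundle X (X g))

/-- The goods which give agent `i` a marginal gain of one. -/
def desired {n : ℕ} {G : Type*} [Fintype G] [DecidableEq G] (v : Fin n → Finset G → ℝ)
    (X : Allocation n G) (i : Fin n) : Set G :=
  {g | v i (insert g (bundle X (some i))) - v i (bundle X (some i)) = 1}

/-- `P` is a path of the exchange graph of `X` from the goods desired by `i` to the unallocated
goods. -/
def IsTransferPath {n : ℕ} {G : Type*} [Fintype G] [DecidableEq G] (v : Fin n → Finset G → ℝ)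
    (X : Allocation n G) (i : Fin n) (P : List G) : Prop :=
  ∃ h : P ≠ [], P.head h ∈ desired v X i ∧ P.getLast h ∈ bundle X none ∧
    P.IsChain (ExchangeEdge v X)

/-- `P` is a shortest such path. -/
def IsShortestTransferPath {n : ℕ} {G : Type*} [Fintype G] [DecidableEq G]
    (v : Fin n → Finset G → ℝ) (X : Allocation n G) (i : Fin n) (P : List G) : Prop :=
  IsTransferPath v X i P ∧ ∀ Q : List G, IsTransferPath v X i Q → P.length ≤ Q.length

/-- Transfer of goods along a path: the first good of the path goes to `o`, and each later good goes
to the agent who owns (in `X`) the good preceding it on the path. -/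
def transfer {n : ℕ} {G : Type*} [DecidableEq G] (X : Allocation n G) :
    Option (Fin n) → List G → Allocation n G
  | _, [] => X
  | o, g :: P => Function.update (transfer X (X g) P) g o

/-! ### General Yankee Swap -/

/-- `x` lexicographically dominates `y`. -/
def LexDominates {b : ℕ} (x y : Fin b → ℝ) : Prop :=
  ∃ k, (∀ j, j < k → x j = y j) ∧ y k < x k

/-- A gain function assigns a `b`-dimensional vector to a utility vector and an agent. -/
abbrev GainFunction (n b : ℕ) : Type := (Fin n → ℝ) → Fin n → (Fin b → ℝ)

/-- The agents in `U` with lexicographically maximal gain. -/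
def gainArgmax {n b : ℕ} (φ : GainFunction n b) (u : Fin n → ℝ) (U : Finset (Fin n)) :
    Set (Fin n) :=
  {i | i ∈ U ∧ ∀ j ∈ U, ¬ LexDominates (φ u j) (φ u i)}

/-- The state of the algorithm: the current allocation and the set of agents still playing. -/
structure State (n : ℕ) (G : Type*) where
  alloc : Allocation n G
  active : Finset (Fin n)

/-- All goods are initially unallocated, and all agents are playing. -/
def initState (n : ℕ) (G : Type*) : State n G := ⟨fun _ => none, Finset.univ⟩

/-- One iteration of the loop of General Yankee Swap. The agent `i` is the one with least index among
the playing agents of maximal gain. If there is a path from the goods that `i` desires to the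
unallocated goods, then goods are transferred along a shortest one (any shortest path may be taken);
otherwise `i` stops playing. -/
inductive Step {n b : ℕ} {G : Type*} [Fintype G] [DecidableEq G] (v : Fin n → Finset G → ℝ)
    (φ : GainFunction n b) : State n G → State n G → Prop
  | augment (X : Allocation n G) (U : Finset (Fin n)) (i : Fin n) (P : List G)
      (hi : IsLeast (gainArgmax φ (utility v X) U) i)
      (hP : IsShortestTransferPath v X i P) :
      Step v φ ⟨X, U⟩ ⟨transfer X (some i) P, U⟩
  | remove (X : Allocation n G) (U : Finset (Fin n)) (i : Fin n)
      (hi : IsLeast (gainArgmax φ (utility v X) U) i)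
      (hP : ¬ ∃ P : List G, IsTransferPath v X i P) :
      Step v φ ⟨X, U⟩ ⟨X, U.erase i⟩

/-- The states that occur in executions of General Yankee Swap. -/
def Reachable {n b : ℕ} {G : Type*} [Fintype G] [DecidableEq G] (v : Fin n → Finset G → ℝ)
    (φ : GainFunction n b) (s : State n G) : Prop :=
  Relation.ReflTransGen (Step v φ) (initState n G) s

/-- General Yankee Swap with gain function `φ` computes an allocation with the property `Q`:
no execution runs forever, no execution gets stuck while agents are still playing, and every
execution that has ended (no agent is playing) returns an allocation with the property `Q`. -/
def Computes {n b : ℕ} {G : Type*} [Fintype G] [DecidableEq G] (v : Fin n → Finset G → ℝ)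
    (φ : GainFunction n b) (Q : Allocation n G → Prop) : Prop :=
  (¬ ∃ r : ℕ → State n G, r 0 = initState n G ∧ ∀ t, Step v φ (r t) (r (t + 1))) ∧
  (∀ s, Reachable v φ s → s.active ≠ ∅ → ∃ s', Step v φ s s') ∧
  (∀ s, Reachable v φ s → s.active = ∅ → Q s.alloc)

/-- The gain function `φ(X, i) = (-v_i(X_i), -π(i))`, as a function of the utility vector. -/
def lorenzGain {n : ℕ} (π : Equiv.Perm (Fin n)) : GainFunction n 2 :=
  fun u i => ![-(u i), -(priority π i)]

end YankeeSwap

namespace YankeeSwap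

/-! Three ingredients carry the proof. (1) Augmentation (`transfer_shortest`): a shortest transfer
path has no chords, so its goods can be moved one at a time, the rest remaining a chordless path for
the agent who has just lost a good. The agent at the start gains one unit and nobody else changes;
bundles stay independent sets. (2) Duality (`exists_isTight`): the goods that cannot reach an
unallocated good act as a cut. It yields a set of agents containing every agent without a transfer
path, whose total utility is already maximal. (3) A certificate for every threshold (`Invariant`).
Levels are perturbed utilities scaled by `n²`, hence integers, and one unit of utility is worth
`n²`. The chosen agent has the lowest level among those playing, so agents of nonzero utility are at
most `n²` above any playing agent. When an agent leaves, ingredient (2) therefore provides tight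
sets for all thresholds from that agent's level upwards; later augmentations avoid these sets, so
they survive to the end. For the final allocation, adding the tight inequalities over the `n²`
integer thresholds just below `t` shows that it maximizes the sum of `min (level) t` for every
integer `t` (`Invariant.sum_min_level_le`). Such truncated sums control the sums of smallest entries
(`sumSmallest_le_of_sum_min_le`). -/

/-- Natural-number valued matroid rank functions. -/
structure IsNatRank {G : Type*} [DecidableEq G] (r : Finset G → ℕ) : Prop where
  empty : r ∅ = 0
  le_insert : ∀ (S : Finset G) (g : G), r S ≤ r (insert g S)
  insert_le : ∀ (S : Finset G) (g : G), r (insert g S) ≤ r S + 1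
  submodular : ∀ (S T : Finset G) (g : G), S ⊆ T → r (insert g T) + r S ≤ r (insert g S) + r T

theorem IsMRF.exists_natRank {G : Type*} [DecidableEq G] {f : Finset G → ℝ} (hf : IsMRF f) :
    ∃ r : Finset G → ℕ, IsNatRank r ∧ ∀ S, f S = r S := by
  have h : ∀ S, ∃ m : ℕ, f S = m := by
    intro S
    induction S using Finset.induction_on with
    | empty => exact ⟨0, by simp [hf.empty]⟩
    | insert g S _ ih =>
      obtain ⟨m, hm⟩ := ih
      rcases hf.marginal S g with h | h
      · exact ⟨m, by linarith⟩
      · exact ⟨m + 1, by push_cast; linarith⟩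
  choose r hr using h
  refine ⟨r, ⟨?_, ?_, ?_, ?_⟩, hr⟩
  · have := hf.empty
    rw [hr] at this
    exact_mod_cast this
  · intro S g
    have := hf.marginal S g
    rw [hr, hr] at this
    have h2 : (r S : ℝ) ≤ r (insert g S) := by rcases this with h | h <;> linarith
    exact_mod_cast h2
  · intro S g
    have := hf.marginal S g
    rw [hr, hr] at this
    have h2 : (r (insert g S) : ℝ) ≤ r S + 1 := by rcases this with h | h <;> linarith
    exact_mod_cast h2
  · intro S T g hST
    have := hf.submodular S T g hST
    rw [hr, hr, hr, hr] at this
    have h2 : (r (insert g T) : ℝ) + r S ≤ r (insert g S) + r T := by linarith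
    exact_mod_cast h2

/-! ### Submodularity and spans inside independent sets -/

namespace IsNatRank

variable {G : Type*} [DecidableEq G] {r : Finset G → ℕ}

theorem union_add_le (hr : IsNatRank r) {S T : Finset G} (hST : S ⊆ T) (Q : Finset G) :
    r (T ∪ Q) + r S ≤ r (S ∪ Q) + r T := by
  induction Q using Finset.induction_on with
  | empty => simp [add_comm]
  | insert g Q _ ih =>
    have := hr.submodular (S ∪ Q) (T ∪ Q) g (Finset.union_subset_union_left hST)
    rw [Finset.union_insert, Finset.union_insert]
    omega

theorem union_add_inter_le (hr : IsNatRank r) (S T : Finset G) :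
    r (S ∪ T) + r (S ∩ T) ≤ r S + r T := by
  have h := hr.union_add_le (Finset.inter_subset_left : S ∩ T ⊆ S) T
  rw [Finset.union_eq_right.2 Finset.inter_subset_right] at h
  omega

theorem mono (hr : IsNatRank r) {S T : Finset G} (h : S ⊆ T) : r S ≤ r T := by
  have key : ∀ Q, r S ≤ r (S ∪ Q) := by
    intro Q
    induction Q using Finset.induction_on with
    | empty => simp
    | insert g Q _ ih =>
      rw [Finset.union_insert]
      exact ih.trans (hr.le_insert _ _)
  simpa [Finset.union_eq_right.2 h] using key T

theorem union_le_add_card (hr : IsNatRank r) (S Q : Finset G) : r (S ∪ Q) ≤ r S + Q.card := by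
  induction Q using Finset.induction_on with
  | empty => simp
  | insert g Q hg ih =>
    rw [Finset.union_insert, Finset.card_insert_of_notMem hg]
    have := hr.insert_le (S ∪ Q) g
    omega

theorem le_card (hr : IsNatRank r) (S : Finset G) : r S ≤ S.card := by
  simpa [hr.empty] using hr.union_le_add_card ∅ S

theorem eq_card_of_subset (hr : IsNatRank r) {S T : Finset G} (h : S ⊆ T) (hT : r T = T.card) :
    r S = S.card := by
  have h1 := hr.union_le_add_card S (T \ S)
  rw [Finset.union_sdiff_of_subset h, Finset.card_sdiff_of_subset h] at h1
  have h2 := hr.le_card S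
  have h3 := Finset.card_le_card h
  omega

theorem insert_eq_of_subset (hr : IsNatRank r) {S T : Finset G} (h : S ⊆ T) {g : G}
    (hg : r (insert g S) = r S) : r (insert g T) = r T := by
  have h1 := hr.submodular S T g h
  have h2 := hr.le_insert T g
  omega

/-- Two subsets of an independent set which span `g` have an intersection which spans `g`. -/
theorem insert_inter_eq (hr : IsNatRank r) {X A B : Finset G} (hX : r X = X.card) (hA : A ⊆ X)
    (hB : B ⊆ X) {g : G} (h1 : r (insert g A) = r A) (h2 : r (insert g B) = r B) :
    r (insert g (A ∩ B)) = r (A ∩ B) := by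
  -- As `A` and `B` span `g`, submodularity gives `r (A ∪ B) + r (insert g (A ∩ B)) ≤ r A + r B`.
  -- Independence turns the right side into `|A ∪ B| + |A ∩ B|`.
  have h3 := hr.union_add_inter_le (insert g A) (insert g B)
  rw [← Finset.insert_inter_distrib] at h3
  have h4 : r (A ∪ B) ≤ r (insert g A ∪ insert g B) :=
    hr.mono (Finset.union_subset_union (Finset.subset_insert _ _) (Finset.subset_insert _ _))
  have h5 := hr.eq_card_of_subset (Finset.union_subset hA hB) hX
  have h6 := hr.eq_card_of_subset hA hX
  have h7 := hr.eq_card_of_subset hB hX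
  have h8 := hr.eq_card_of_subset (Finset.inter_subset_left.trans hA : A ∩ B ⊆ X) hX
  have h9 := Finset.card_union_add_card_inter A B
  have h10 := hr.le_insert (A ∩ B) g
  omega

theorem union_eq_of_forall_insert (hr : IsNatRank r) {S Q : Finset G}
    (h : ∀ g ∈ Q, r (insert g S) = r S) : r (S ∪ Q) = r S := by
  induction Q using Finset.induction_on with
  | empty => simp
  | insert g Q _ ih =>
    rw [Finset.union_insert, hr.insert_eq_of_subset Finset.subset_union_left
      (h g (Finset.mem_insert_self _ _))]
    exact ih fun x hx => h x (Finset.mem_insert_of_mem hx)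

end IsNatRank

/-! ### Non-redundant allocations and their exchange graphs -/

theorem mem_bundle {n : ℕ} {G : Type*} [Fintype G] {X : Allocation n G} {o : Option (Fin n)} {g : G} :
    g ∈ bundle X o ↔ X g = o := by simp [bundle]

/-- `transfer` reassigns the first good of a path last. Commuting the updates lets it be reassigned
first, which makes induction along the path possible. -/
theorem transfer_update {n : ℕ} {G : Type*} [DecidableEq G] {X : Allocation n G} {g : G} (o : Option (Fin n)) (P : List G)
    (hg : g ∉ P) (o' : Option (Fin n)) :
    transfer (Function.update X g o) o' P = Function.update (transfer X o' P) g o := by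
  induction P generalizing o' with
  | nil => rfl
  | cons h P ih =>
    simp only [List.mem_cons, not_or] at hg
    simp only [transfer]
    rw [ih hg.2, Function.update_of_ne (Ne.symm hg.1), Function.update_comm hg.1]

variable {n : ℕ} {G : Type*} [Fintype G] [DecidableEq G]

/-- Real valuations given by natural-number valued ones. -/
abbrev realVal (r : Fin n → Finset G → ℕ) : Fin n → Finset G → ℝ := fun i S => (r i S : ℝ)

/-- Every agent values their bundle at its size. -/
def NonRedundant (r : Fin n → Finset G → ℕ) (X : Allocation n G) : Prop :=
  ∀ i, r i (bundle X (some i)) = (bundle X (some i)).card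

theorem exchangeEdge_iff {r : Fin n → Finset G → ℕ} {X : Allocation n G} {g g' : G} {k : Fin n}
    (hg : X g = some k) : ExchangeEdge (realVal r) X g g' ↔
      g ≠ g' ∧ r k (insert g' ((bundle X (some k)).erase g)) = r k (bundle X (some k)) := by
  simp [ExchangeEdge, hg, extVal]

theorem mem_desired_iff {r : Fin n → Finset G → ℕ} {X : Allocation n G} {g : G} {i : Fin n} :
    g ∈ desired (realVal r) X i ↔
      r i (insert g (bundle X (some i))) = r i (bundle X (some i)) + 1 := by
  simp only [desired, realVal, Set.mem_ofPred_eq]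
  rw [sub_eq_iff_eq_add]
  constructor
  · intro h
    have : ((r i (insert g (bundle X (some i))) : ℕ) : ℝ) = ((r i (bundle X (some i)) + 1 : ℕ) : ℝ) := by
      push_cast; linarith
    exact_mod_cast this
  · intro h
    rw [h]; push_cast; ring

theorem not_mem_desired_iff {r : Fin n → Finset G → ℕ} {i : Fin n} (hr : IsNatRank (r i))
    {X : Allocation n G} {g : G} : g ∉ desired (realVal r) X i ↔
      r i (insert g (bundle X (some i))) = r i (bundle X (some i)) := by
  rw [mem_desired_iff]
  have h1 := hr.le_insert (bundle X (some i)) g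
  have h2 := hr.insert_le (bundle X (some i)) g
  omega

/-- In a non-redundant allocation, a missing exchange edge means that the remaining goods span. -/
theorem not_exchangeEdge_iff {r : Fin n → Finset G → ℕ} {k : Fin n} (hr : IsNatRank (r k))
    {X : Allocation n G} (hX : NonRedundant r X) {g g' : G} (hg : X g = some k) (hne : g ≠ g') :
    ¬ ExchangeEdge (realVal r) X g g' ↔
      r k (insert g' ((bundle X (some k)).erase g)) = r k ((bundle X (some k)).erase g) := by
  rw [exchangeEdge_iff hg]
  have h1 := hr.le_insert ((bundle X (some k)).erase g) g'
  have h2 := hr.insert_le ((bundle X (some k)).erase g) g'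
  have h3 := hr.eq_card_of_subset (Finset.erase_subset g (bundle X (some k))) (hX k)
  have h4 := Finset.card_erase_add_one (mem_bundle.2 hg)
  have h5 := hX k
  simp only [hne, ne_eq, not_false_eq_true, true_and]
  omega

/-! ### Augmentation along induced paths -/

/-- Paths of the exchange graph to the unallocated goods without chords. -/
def IsInducedPath (v : Fin n → Finset G → ℝ) (X : Allocation n G) : List G → Prop
  | [] => False
  | [g] => X g = none
  | g :: h :: P => X g ≠ none ∧ ExchangeEdge v X g h ∧ (∀ x ∈ P, ¬ ExchangeEdge v X g x) ∧
      g ∉ h :: P ∧ IsInducedPath v X (h :: P)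

theorem bundle_update_self (X : Allocation n G) (g : G) (o : Option (Fin n)) :
    bundle (Function.update X g o) o = insert g (bundle X o) := by
  ext x
  by_cases h : x = g <;> simp [bundle, h]

theorem bundle_update_of_ne (X : Allocation n G) (g : G) {o o' : Option (Fin n)} (h : o' ≠ o) :
    bundle (Function.update X g o) o' = (bundle X o').erase g := by
  ext x
  by_cases hx : x = g
  · subst hx; simp [bundle, h.symm]
  · simp [bundle, hx]

/-- Only the bundles of `i` and `k` change. The bundle of `i` already spans `b`, so adding the
independent good `g` does not affect which goods `b` can replace. The bundle of `k` without `g`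
still spans `b`; by `insert_inter_eq`, removing `a` as well destroys this exactly when removing `a`
alone does. -/
theorem exchangeEdge_update_iff {r : Fin n → Finset G → ℕ} (hr : ∀ i, IsNatRank (r i))
    {X : Allocation n G} (hX : NonRedundant r X) {i k : Fin n} {g a b : G} (hg : X g = some k)
    (hgi : g ∈ desired (realVal r) X i)
    (hag : a ≠ g) (ha : X a ≠ none) (hbg : b ≠ g) (hbi : b ∉ desired (realVal r) X i)
    (hgb : ¬ ExchangeEdge (realVal r) X g b) :
    ExchangeEdge (realVal r) (Function.update X g (some i)) a b ↔
      ExchangeEdge (realVal r) X a b := by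
  obtain ⟨l, hl⟩ := Option.ne_none_iff_exists'.1 ha
  have hl' : Function.update X g (some i) a = some l := by rw [Function.update_of_ne hag, hl]
  rw [mem_desired_iff] at hgi
  rw [not_mem_desired_iff (hr i)] at hbi
  rw [not_exchangeEdge_iff (hr k) hX hg hbg.symm] at hgb
  rw [exchangeEdge_iff hl, exchangeEdge_iff hl']
  refine and_congr_right fun hab => ?_
  by_cases hli : l = i
  · subst hli
    rw [bundle_update_self]
    have hal := mem_bundle.2 hl
    rw [Finset.erase_insert_of_ne hag.symm, Finset.insert_comm]
    set B := bundle X (some l) with hB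
    have hc := hX l
    rw [← hB] at hc
    have e1 := (hr l).le_insert (B.erase a) b
    have e2 := (hr l).insert_le (B.erase a) b
    have e3 := (hr l).eq_card_of_subset (Finset.erase_subset a B) hc
    have e4 := Finset.card_erase_add_one hal
    have e5 := (hr l).insert_le (insert b (B.erase a)) g
    constructor
    · intro h
      have : r l (insert b (B.erase a)) ≤ r l (insert b B) :=
        (hr l).mono (Finset.insert_subset_insert _ (Finset.erase_subset _ _))
      omega
    · intro h
      have s1 := (hr l).submodular (insert b (B.erase a)) (insert b B) g
        (Finset.insert_subset_insert _ (Finset.erase_subset _ _))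
      have s2 : r l (insert g B) ≤ r l (insert g (insert b B)) :=
        (hr l).mono (Finset.insert_subset_insert _ (Finset.subset_insert _ _))
      omega
  · rw [bundle_update_of_ne _ _ (by simpa using hli)]
    by_cases hlk : l = k
    · subst hlk
      set B := bundle X (some l) with hB
      have hc := hX l
      rw [← hB] at hc
      have hal : a ∈ B := mem_bundle.2 hl
      have hgl : g ∈ B := mem_bundle.2 hg
      have e1 := (hr l).eq_card_of_subset (Finset.erase_subset g B) hc
      have e2 := (hr l).eq_card_of_subset (Finset.erase_subset a B) hc
      have e3 := (hr l).eq_card_of_subset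
        ((Finset.erase_subset a _).trans (Finset.erase_subset g B)) hc
      have c1 := Finset.card_erase_add_one hgl
      have c2 := Finset.card_erase_add_one hal
      have c3 := Finset.card_erase_add_one (Finset.mem_erase.2 ⟨hag, hal⟩)
      have m1 := (hr l).insert_le ((B.erase g).erase a) b
      have m2 := (hr l).le_insert ((B.erase g).erase a) b
      have m3 := (hr l).insert_le (B.erase a) b
      have m4 := (hr l).le_insert (B.erase a) b
      constructor
      · intro h
        by_contra hcon
        have hspan : r l (insert b (B.erase a)) = r l (B.erase a) := by omega
        have := (hr l).insert_inter_eq hc (Finset.erase_subset g B) (Finset.erase_subset a B)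
          hgb hspan
        have hi : B.erase g ∩ B.erase a = (B.erase g).erase a := by
          ext x; simp only [Finset.mem_inter, Finset.mem_erase]; tauto
        rw [hi] at this
        omega
      · intro h
        have s := (hr l).submodular ((B.erase g).erase a) (B.erase a) b
          (Finset.erase_subset_erase _ (Finset.erase_subset _ _))
        omega
    · have hgl : g ∉ bundle X (some l) := by
        rw [mem_bundle, hg]; simpa using Ne.symm hlk
      rw [Finset.erase_eq_of_notMem hgl]

/-- Only targets of edges must be neither desired by `i` nor reachable by an edge from `g`. The head
of `Q` is exempt, as it has to be: in the application it is the successor of `g`. -/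
theorem IsInducedPath.update {r : Fin n → Finset G → ℕ} (hr : ∀ i, IsNatRank (r i))
    {X : Allocation n G} (hX : NonRedundant r X) {i k : Fin n} {g : G} (hg : X g = some k)
    (hgi : g ∈ desired (realVal r) X i) {Q : List G} (hgQ : g ∉ Q)
    (hQ : ∀ b ∈ Q.tail, b ∉ desired (realVal r) X i ∧ ¬ ExchangeEdge (realVal r) X g b)
    (h : IsInducedPath (realVal r) X Q) :
    IsInducedPath (realVal r) (Function.update X g (some i)) Q := by
  induction Q with
  | nil => exact h
  | cons a Q ih =>
    simp only [List.mem_cons, not_or] at hgQ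
    cases Q with
    | nil =>
      simp only [IsInducedPath] at h ⊢
      rw [Function.update_of_ne (Ne.symm hgQ.1), h]
    | cons b Q =>
      simp only [IsInducedPath] at h ⊢
      obtain ⟨h1, h2, h3, h4, h5⟩ := h
      have key : ∀ x ∈ b :: Q, (ExchangeEdge (realVal r) (Function.update X g (some i)) a x ↔
          ExchangeEdge (realVal r) X a x) := fun x hx =>
        exchangeEdge_update_iff hr hX hg hgi (Ne.symm hgQ.1) h1
          (fun e => hgQ.2 (e ▸ hx)) (hQ x hx).1 (hQ x hx).2
      refine ⟨by rwa [Function.update_of_ne (Ne.symm hgQ.1)], (key b (by simp)).2 h2,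
        fun x hx => ?_, h4, ih hgQ.2 (fun x hx => hQ x (List.mem_cons_of_mem _ hx)) h5⟩
      rw [key x (List.mem_cons_of_mem _ hx)]
      exact h3 x hx

/-- Transferring along a chordless path gives one more unit to the first agent, and changes no other
utility. -/
theorem transfer_induced {r : Fin n → Finset G → ℕ} (hr : ∀ i, IsNatRank (r i)) (P : List G)
    {X : Allocation n G} (hX : NonRedundant r X) {i : Fin n} {g : G}
    (hgi : g ∈ desired (realVal r) X i) (hP : ∀ x ∈ P, x ∉ desired (realVal r) X i)
    (h : IsInducedPath (realVal r) X (g :: P)) :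
    NonRedundant r (transfer X (some i) (g :: P)) ∧
      ∀ k, (bundle (transfer X (some i) (g :: P)) (some k)).card =
        (bundle X (some k)).card + if k = i then 1 else 0 := by
  induction P generalizing X i g with
  | nil =>
    simp only [IsInducedPath] at h
    have hgi' := mem_desired_iff.1 hgi
    have hcard : ∀ k, (bundle (transfer X (some i) [g]) (some k)).card =
        (bundle X (some k)).card + if k = i then 1 else 0 := by
      intro k
      simp only [transfer]
      by_cases hk : k = i
      · subst hk
        rw [bundle_update_self, Finset.card_insert_of_notMem (by simp [mem_bundle, h])]
        simp
      · rw [bundle_update_of_ne _ _ (by simpa using hk),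
          Finset.erase_eq_of_notMem (by simp [mem_bundle, h])]
        simp [hk]
    refine ⟨fun k => ?_, hcard⟩
    rw [hcard]
    simp only [transfer]
    by_cases hk : k = i
    · subst hk
      rw [bundle_update_self, hgi', hX k]
      simp
    · rw [bundle_update_of_ne _ _ (by simpa using hk),
        Finset.erase_eq_of_notMem (by simp [mem_bundle, h]), hX k]
      simp [hk]
  | cons b P ih =>
    simp only [IsInducedPath] at h
    obtain ⟨h1, h2, h3, h4, h5⟩ := h
    obtain ⟨k, hk⟩ := Option.ne_none_iff_exists'.1 h1
    have hgi' := mem_desired_iff.1 hgi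
    have hgk : g ∈ bundle X (some k) := mem_bundle.2 hk
    have hki : k ≠ i := by
      rintro rfl
      rw [Finset.insert_eq_of_mem hgk] at hgi'
      omega
    have hgX : g ∉ bundle X (some i) := by rw [mem_bundle, hk]; simpa using hki
    -- In the intermediate allocation `i` has gained `g` and `k` has lost it; the remaining path
    -- starts anew with `k` as the beneficiary.
    set X1 := Function.update X g (some i) with hX1
    have hbi : bundle X1 (some i) = insert g (bundle X (some i)) := bundle_update_self _ _ _
    have hbo : ∀ l, l ≠ i → bundle X1 (some l) = (bundle X (some l)).erase g := fun l hl =>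
      bundle_update_of_ne _ _ (by simpa using hl)
    have hX1r : NonRedundant r X1 := by
      intro l
      by_cases hl : l = i
      · subst hl
        rw [hbi, hgi', hX l, Finset.card_insert_of_notMem hgX]
      · rw [hbo l hl]
        exact (hr l).eq_card_of_subset (Finset.erase_subset _ _) (hX l)
    have hcard := Finset.card_erase_add_one hgk
    have hrk := (hr k).eq_card_of_subset (Finset.erase_subset g (bundle X (some k))) (hX k)
    have hXk := hX k
    -- Losing `g` costs `k` one unit, and the exchange edge from `g` to `b` says that `b` restores
    -- it.
    have hb : b ∈ desired (realVal r) X1 k := by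
      rw [mem_desired_iff, hbo k hki]
      have := ((exchangeEdge_iff hk).1 h2).2
      omega
    -- A later good desired by `k` would be the end of a chord from `g`.
    have hP1 : ∀ x ∈ P, x ∉ desired (realVal r) X1 k := by
      intro x hx
      rw [not_mem_desired_iff (hr k), hbo k hki]
      exact (not_exchangeEdge_iff (hr k) hX hk
        (fun e => h4 (e ▸ List.mem_cons_of_mem _ hx))).1 (h3 x hx)
    have hind1 : IsInducedPath (realVal r) X1 (b :: P) :=
      h5.update hr hX hk hgi h4 fun x hx =>
        ⟨hP x (List.mem_cons_of_mem _ hx), h3 x hx⟩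
    obtain ⟨r1, r2⟩ := ih hX1r hb hP1 hind1
    have ht : transfer X (some i) (g :: b :: P) = transfer X1 (some k) (b :: P) := by
      rw [hX1, transfer_update _ _ h4, ← hk]
      rfl
    rw [ht]
    refine ⟨r1, fun l => ?_⟩
    rw [r2]
    by_cases hl : l = i
    · subst hl
      rw [hbi, Finset.card_insert_of_notMem hgX]
      simp [hki.symm]
    · rw [hbo l hl]
      by_cases hlk : l = k
      · subst hlk
        simp [hki, hcard]
      · have : g ∉ bundle X (some l) := by rw [mem_bundle, hk]; simpa using Ne.symm hlk
        rw [Finset.erase_eq_of_notMem this]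
        simp [hl, hlk]

/-! ### Shortest paths are induced -/

/-- Paths of the exchange graph that end in the unallocated goods. -/
def IsEscape (v : Fin n → Finset G → ℝ) (X : Allocation n G) (P : List G) : Prop :=
  ∃ h : P ≠ [], X (P.getLast h) = none ∧ P.IsChain (ExchangeEdge v X)

theorem IsEscape.suffix {v : Fin n → Finset G → ℝ} {X : Allocation n G} {l : List G} {x : G}
    {P : List G} (h : IsEscape v X (l ++ x :: P)) : IsEscape v X (x :: P) := by
  obtain ⟨h1, h2, h3⟩ := h
  refine ⟨by simp, ?_, ?_⟩
  · rwa [List.getLast_append_of_ne_nil _ (by simp)] at h2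
  · exact h3.suffix (List.suffix_append _ _)

theorem IsEscape.cons {v : Fin n → Finset G → ℝ} {X : Allocation n G} {g x : G} {P : List G}
    (hg : ExchangeEdge v X g x) (h : IsEscape v X (x :: P)) : IsEscape v X (g :: x :: P) := by
  obtain ⟨h1, h2, h3⟩ := h
  refine ⟨by simp, ?_, List.isChain_cons_cons.2 ⟨hg, h3⟩⟩
  rwa [List.getLast_cons h1]

/-- An unallocated good before the end, a chord or a repeated good would each give a shorter path
from the same good. -/
theorem IsEscape.isInducedPath {v : Fin n → Finset G → ℝ} {X : Allocation n G} {g : G} {P : List G}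
    (h : IsEscape v X (g :: P)) (hmin : ∀ Q, IsEscape v X (g :: Q) → P.length ≤ Q.length) :
    IsInducedPath v X (g :: P) := by
  induction P generalizing g with
  | nil =>
    obtain ⟨h1, h2, h3⟩ := h
    simpa [IsInducedPath] using h2
  | cons b P ih =>
    have htail : IsEscape v X (b :: P) := IsEscape.suffix (l := [g]) h
    refine ⟨fun hg => ?_, ?_, fun x hx hgx => ?_, fun hg => ?_, ?_⟩
    · have := hmin [] ⟨by simp, by simpa using hg, by simp⟩
      simp at this
    · obtain ⟨h1, h2, h3⟩ := h
      exact (List.isChain_cons_cons.1 h3).1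
    · obtain ⟨s, t, rfl⟩ := List.append_of_mem hx
      have h1 : IsEscape v X (x :: t) := IsEscape.suffix (l := b :: s) htail
      have := hmin _ (h1.cons hgx)
      simp at this
      omega
    · obtain ⟨s, t, hst⟩ := List.append_of_mem hg
      rw [hst] at htail hmin
      have := hmin _ htail.suffix
      simp at this
      omega
    · refine ih htail fun Q hQ => ?_
      have hgb : ExchangeEdge v X g b := by
        obtain ⟨h1, h2, h3⟩ := h
        exact (List.isChain_cons_cons.1 h3).1
      have := hmin _ (hQ.cons hgb)
      simpa using this

theorem isTransferPath_cons {v : Fin n → Finset G → ℝ} {X : Allocation n G} {i : Fin n} {g : G}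
    {P : List G} : IsTransferPath v X i (g :: P) ↔ g ∈ desired v X i ∧ IsEscape v X (g :: P) := by
  simp [IsTransferPath, IsEscape, mem_bundle]

theorem exists_shortestTransferPath {v : Fin n → Finset G → ℝ} {X : Allocation n G} {i : Fin n}
    (h : ∃ P, IsTransferPath v X i P) : ∃ P, IsShortestTransferPath v X i P := by
  obtain ⟨P, hP, hmin⟩ := WellFounded.has_min (measure (List.length (α := G))).wf
    {P | IsTransferPath v X i P} h
  exact ⟨P, hP, fun Q hQ => not_lt.1 (hmin Q hQ)⟩

/-- Transferring along a shortest path gives one more unit to agent `i`, and changes no other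
utility. -/
theorem transfer_shortest {r : Fin n → Finset G → ℕ} (hr : ∀ i, IsNatRank (r i))
    {X : Allocation n G} (hX : NonRedundant r X) {i : Fin n} {P : List G}
    (hP : IsShortestTransferPath (realVal r) X i P) :
    NonRedundant r (transfer X (some i) P) ∧
      ∀ k, r k (bundle (transfer X (some i) P) (some k)) =
        r k (bundle X (some k)) + if k = i then 1 else 0 := by
  obtain ⟨hP, hmin⟩ := hP
  cases P with
  | nil => exact absurd rfl hP.choose
  | cons g P =>
    obtain ⟨hg, hesc⟩ := isTransferPath_cons.1 hP
    obtain ⟨h1, h2⟩ := transfer_induced hr P hX hg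
      (fun x hx hxi => by
        obtain ⟨s, t, rfl⟩ := List.append_of_mem hx
        have h1 : IsEscape (realVal r) X (x :: t) := IsEscape.suffix (l := g :: s) hesc
        have := hmin _ (isTransferPath_cons.2 ⟨hxi, h1⟩)
        simp at this
        omega)
      (hesc.isInducedPath fun Q hQ => by
        simpa using hmin _ (isTransferPath_cons.2 ⟨hg, hQ⟩))
    refine ⟨h1, fun k => ?_⟩
    rw [h1 k, h2, hX k]

/-! ### Tight sets of agents -/

/-- No allocation gives a larger total utility to the agents in `T`. -/
def IsTight (r : Fin n → Finset G → ℕ) (X : Allocation n G) (T : Finset (Fin n)) : Prop :=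
  ∀ Y : Allocation n G, ∑ k ∈ T, r k (bundle Y (some k)) ≤ ∑ k ∈ T, r k (bundle X (some k))

theorem sum_card_bundle_inter_le (Y : Allocation n G) (T : Finset (Fin n)) (R : Finset G) :
    ∑ k ∈ T, (bundle Y (some k) ∩ R).card ≤ R.card := by
  rw [← Finset.card_biUnion]
  · exact Finset.card_le_card (Finset.biUnion_subset.2 fun k _ => Finset.inter_subset_right)
  · intro k _ l _ hkl
    rw [Function.onFun, Finset.disjoint_left]
    intro x hx hx'
    simp only [Finset.mem_inter, mem_bundle] at hx hx'
    exact hkl (Option.some_injective _ (hx.1.symm.trans hx'.1))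

/-- All agents without a transfer path belong to one common tight set. -/
theorem exists_isTight {r : Fin n → Finset G → ℕ} (hr : ∀ i, IsNatRank (r i))
    {X : Allocation n G} (hX : NonRedundant r X) :
    ∃ T, IsTight r X T ∧ ∀ i, (¬ ∃ P, IsTransferPath (realVal r) X i P) → i ∈ T := by
  classical
  set R : Finset G := Finset.univ.filter fun g => ¬ ∃ P, IsEscape (realVal r) X (g :: P) with hR
  -- The agents without a transfer path are those who desire only goods of `R`. Owners of goods of
  -- `R` are included so that all of `R` is held within `T`.
  set T : Finset (Fin n) := Finset.univ.filter fun k =>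
    (∃ g ∈ R, X g = some k) ∨ ∀ g ∈ desired (realVal r) X k, g ∈ R with hT
  have hclosed : ∀ g ∈ R, ∀ g', g' ∉ R → ¬ ExchangeEdge (realVal r) X g g' := by
    intro g hg g' hg' hE
    simp only [hR, Finset.mem_filter, Finset.mem_univ, true_and, not_not] at hg hg'
    obtain ⟨P, hP⟩ := hg'
    exact hg ⟨_, hP.cons hE⟩
  -- The goods outside `R` are worth to `k` only what `k` already holds of them. The bundle spans
  -- each such good, and still does after any one owned good of `R` is removed; intersecting these
  -- spanning sets removes all of `R`.
  have hspan : ∀ k ∈ T, r k Rᶜ = (bundle X (some k) \ R).card := by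
    intro k hk
    have hkT := (Finset.mem_filter.1 hk).2
    have h1 : ∀ g' ∉ R, ∀ g ∈ R, X g = some k →
        r k (insert g' ((bundle X (some k)).erase g)) = r k ((bundle X (some k)).erase g) :=
      fun g' hg' g hg hgk => (not_exchangeEdge_iff (hr k) hX hgk
        (by rintro rfl; exact hg' hg)).1 (hclosed g hg g' hg')
    have h2 : ∀ g' ∉ R, r k (insert g' (bundle X (some k))) = r k (bundle X (some k)) := by
      intro g' hg'
      rcases hkT with ⟨g, hg, hgk⟩ | h
      · exact (hr k).insert_eq_of_subset (Finset.erase_subset _ _) (h1 g' hg' g hg hgk)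
      · exact (not_mem_desired_iff (hr k)).1 fun hd => hg' (h g' hd)
    have h3 : ∀ g' ∉ R, ∀ S : Finset G, S ⊆ R →
        r k (insert g' (bundle X (some k) \ S)) = r k (bundle X (some k) \ S) := by
      intro g' hg' S
      induction S using Finset.induction_on with
      | empty => intro _; simpa using h2 g' hg'
      | insert g S _ ih =>
        intro hS
        rw [Finset.insert_subset_iff] at hS
        have ih := ih hS.2
        by_cases hgk : X g = some k
        · have := (hr k).insert_inter_eq (hX k) Finset.sdiff_subset (Finset.erase_subset _ _) ih
            (h1 g' hg' g hS.1 hgk)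
          have e : (bundle X (some k) \ S) ∩ (bundle X (some k)).erase g =
              bundle X (some k) \ insert g S := by
            ext x
            simp only [Finset.mem_inter, Finset.mem_sdiff, Finset.mem_erase, Finset.mem_insert]
            tauto
          rwa [e] at this
        · have e : bundle X (some k) \ insert g S = bundle X (some k) \ S := by
            ext x
            simp only [Finset.mem_sdiff, Finset.mem_insert, mem_bundle]
            constructor
            · tauto
            · rintro ⟨hx, hxS⟩
              refine ⟨hx, ?_⟩
              rintro (rfl | h)
              · exact hgk hx
              · exact hxS h
          rw [e, ih]
    have h4 := (hr k).union_eq_of_forall_insert (S := bundle X (some k) \ R) (Q := Rᶜ)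
      fun g' hg' => h3 g' (Finset.mem_compl.1 hg') R (Finset.Subset.refl _)
    have h5 : bundle X (some k) \ R ∪ Rᶜ = Rᶜ := by
      rw [Finset.union_eq_right]
      intro x hx
      exact Finset.mem_compl.2 (Finset.mem_sdiff.1 hx).2
    rw [h5] at h4
    rw [h4]
    exact (hr k).eq_card_of_subset Finset.sdiff_subset (hX k)
  -- An unallocated good is itself a path of length one, so every good of `R` has an owner, who lies
  -- in `T`.
  have hRcard : R.card ≤ ∑ k ∈ T, (bundle X (some k) ∩ R).card := by
    refine le_trans (Finset.card_le_card ?_) Finset.card_biUnion_le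
    intro g hg
    have hgn : X g ≠ none := fun h =>
      (Finset.mem_filter.1 hg).2 ⟨[], by simp, by simpa using h, by simp⟩
    obtain ⟨k, hk⟩ := Option.ne_none_iff_exists'.1 hgn
    refine Finset.mem_biUnion.2 ⟨k, ?_, Finset.mem_inter.2 ⟨mem_bundle.2 hk, hg⟩⟩
    exact Finset.mem_filter.2 ⟨Finset.mem_univ _, Or.inl ⟨g, hg, hk⟩⟩
  refine ⟨T, fun Y => ?_, fun i hi => ?_⟩
  · calc ∑ k ∈ T, r k (bundle Y (some k))
        ≤ ∑ k ∈ T, ((bundle X (some k) \ R).card + (bundle Y (some k) ∩ R).card) := by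
          refine Finset.sum_le_sum fun k hk => ?_
          rw [← hspan k hk]
          refine le_trans ((hr k).mono ?_) ((hr k).union_le_add_card _ _)
          intro x hx
          by_cases hxR : x ∈ R <;> simp [hx, hxR]
      _ ≤ ∑ k ∈ T, (bundle X (some k) \ R).card + R.card := by
          rw [Finset.sum_add_distrib]
          exact Nat.add_le_add_left (sum_card_bundle_inter_le _ _ _) _
      _ ≤ ∑ k ∈ T, (bundle X (some k) \ R).card + ∑ k ∈ T, (bundle X (some k) ∩ R).card :=
          Nat.add_le_add_left hRcard _
      _ = ∑ k ∈ T, r k (bundle X (some k)) := by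
          rw [← Finset.sum_add_distrib]
          refine Finset.sum_congr rfl fun k _ => ?_
          rw [hX k, Finset.card_sdiff_add_card_inter]
  · refine Finset.mem_filter.2 ⟨Finset.mem_univ _, Or.inr fun g hg => ?_⟩
    refine Finset.mem_filter.2 ⟨Finset.mem_univ _, ?_⟩
    rintro ⟨P, hP⟩
    exact hi ⟨_, isTransferPath_cons.2 ⟨hg, hP⟩⟩

/-! ### Sums of smallest entries -/

theorem sum_filter_lt_card (n k : ℕ) (hk : k ≤ n) :
    (Finset.univ.filter fun j : Fin n => (j : ℕ) < k).card = k := by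
  rw [Fin.card_filter_val_lt]
  exact min_eq_right hk

theorem sum_min_le_sumSmallest {n : ℕ} (x : Fin n → ℝ) (t : ℝ) {k : ℕ} (hk : k ≤ n) :
    ∑ i, min (x i) t ≤ sumSmallest x k + (n - k) * t := by
  rw [← Equiv.sum_comp (Tuple.sort x),
    ← Finset.sum_filter_add_sum_filter_not Finset.univ (fun j : Fin n => (j : ℕ) < k)]
  refine add_le_add (Finset.sum_le_sum fun j _ => min_le_left _ _) ?_
  refine (Finset.sum_le_card_nsmul _ _ t fun j _ => min_le_right _ _).trans_eq ?_
  have h := Finset.card_filter_add_card_filter_not (s := Finset.univ)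
    (fun j : Fin n => (j : ℕ) < k)
  rw [sum_filter_lt_card n k hk, Finset.card_univ, Fintype.card_fin] at h
  have h' : (k : ℝ) + (Finset.univ.filter fun j : Fin n => ¬ (j : ℕ) < k).card = n := by
    exact_mod_cast h
  rw [nsmul_eq_mul]
  linear_combination t * h'

/-- The bound `sum_min_le_sumSmallest` is attained at the `k`-th smallest entry, which has index `k
- 1`. -/
theorem sumSmallest_add_eq_sum_min {n : ℕ} (y : Fin n → ℝ) {k : ℕ} (h1 : 1 ≤ k) (hk : k ≤ n) :
    sumSmallest y k + (n - k) * sortedVec y ⟨k - 1, by omega⟩ =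
      ∑ i, min (y i) (sortedVec y ⟨k - 1, by omega⟩) := by
  set t := sortedVec y ⟨k - 1, by omega⟩ with ht
  have hmono : Monotone (sortedVec y) := Tuple.monotone_sort y
  rw [← Equiv.sum_comp (Tuple.sort y),
    ← Finset.sum_filter_add_sum_filter_not Finset.univ (fun j : Fin n => (j : ℕ) < k)]
  have h := Finset.card_filter_add_card_filter_not (s := Finset.univ)
    (fun j : Fin n => (j : ℕ) < k)
  rw [sum_filter_lt_card n k hk, Finset.card_univ, Fintype.card_fin] at h
  have h' : (k : ℝ) + (Finset.univ.filter fun j : Fin n => ¬ (j : ℕ) < k).card = n := by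
    exact_mod_cast h
  congr 1
  · refine Finset.sum_congr rfl fun j hj => ?_
    have hj := (Finset.mem_filter.1 hj).2
    have : sortedVec y j ≤ t := hmono (Fin.le_def.2 (by simp; omega))
    exact (min_eq_left this).symm
  · rw [Finset.sum_congr rfl (g := fun _ => t), Finset.sum_const, nsmul_eq_mul]
    · linear_combination -t * h'
    · intro j hj
      have hj := (Finset.mem_filter.1 hj).2
      have : t ≤ sortedVec y j := hmono (Fin.le_def.2 (by simp; omega))
      exact min_eq_right this

/-- Truncating at the `k`-th smallest entry of `y` gives equality for `y` and an upper bound for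
`x`, with the same term `(n - k) * t` on both sides. Only entries of `y` are needed as thresholds.
-/
theorem sumSmallest_le_of_sum_min_le {n : ℕ} {x y : Fin n → ℝ}
    (h : ∀ i, ∑ j, min (y j) (y i) ≤ ∑ j, min (x j) (y i)) {k : ℕ} (h1 : 1 ≤ k) (hk : k ≤ n) :
    sumSmallest y k ≤ sumSmallest x k := by
  have e1 := sumSmallest_add_eq_sum_min y h1 hk
  have e2 := sum_min_le_sumSmallest x (sortedVec y ⟨k - 1, by omega⟩) hk
  have e3 := h (Tuple.sort y ⟨k - 1, by omega⟩)
  change ∑ j, min (y j) (sortedVec y ⟨k - 1, by omega⟩) ≤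
    ∑ j, min (x j) (sortedVec y ⟨k - 1, by omega⟩) at e3
  linarith

/-! ### The invariant of the algorithm -/

/-- The perturbed utility of agent `i`, multiplied by `n²`. -/
def level (r : Fin n → Finset G → ℕ) (π : Equiv.Perm (Fin n)) (X : Allocation n G) (i : Fin n) :
    ℤ :=
  (n : ℤ) ^ 2 * r i (bundle X (some i)) + ((π i : ℕ) + 1)

/-- Priorities differ by less than `n ≤ n²`, so they only break ties between equal utilities. -/
theorem level_lt_level_iff {n : ℕ} {G : Type*} [Fintype G]
    (r : Fin n → Finset G → ℕ) (π : Equiv.Perm (Fin n))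
    (X : Allocation n G) (i j : Fin n) : level r π X j < level r π X i ↔
      LexDominates (lorenzGain π (utility (realVal r) X) j)
        (lorenzGain π (utility (realVal r) X) i) := by
  have h : LexDominates (lorenzGain π (utility (realVal r) X) j)
        (lorenzGain π (utility (realVal r) X) i) ↔
      r j (bundle X (some j)) < r i (bundle X (some i)) ∨
        r j (bundle X (some j)) = r i (bundle X (some i)) ∧ (π j : ℕ) < π i := by
    simp only [LexDominates, Fin.exists_fin_two, Fin.forall_fin_two, lorenzGain, utility, priority]
    simp only [Matrix.cons_val_zero, Matrix.cons_val_one, neg_lt_neg_iff, neg_inj,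
      add_lt_add_iff_right, Nat.cast_lt, Nat.cast_inj]
    simp
  rw [h]
  have hi := (π i).isLt
  have hj := (π j).isLt
  have hn : (n : ℤ) ≤ (n : ℤ) ^ 2 := by nlinarith
  unfold level
  set a := r i (bundle X (some i))
  set b := r j (bundle X (some j))
  rcases lt_trichotomy b a with hab | hab | hab
  · have : (b : ℤ) + 1 ≤ a := by exact_mod_cast hab
    have : (n : ℤ) ^ 2 * (b + 1) ≤ (n : ℤ) ^ 2 * a := by gcongr
    simp only [hab, true_or, iff_true]
    linarith
  · rw [hab]
    simp
  · have h1 : (a : ℤ) + 1 ≤ b := by exact_mod_cast hab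
    have : (n : ℤ) ^ 2 * (a + 1) ≤ (n : ℤ) ^ 2 * b := by gcongr
    have h2 : ¬ b < a := by omega
    have h3 : b ≠ a := by omega
    simp only [h2, h3, false_and, or_false, iff_false, not_lt]
    linarith

theorem mem_gainArgmax_iff {r : Fin n → Finset G → ℕ} {π : Equiv.Perm (Fin n)}
    {X : Allocation n G} {U : Finset (Fin n)} {i : Fin n} :
    i ∈ gainArgmax (lorenzGain π) (utility (realVal r) X) U ↔
      i ∈ U ∧ ∀ j ∈ U, level r π X i ≤ level r π X j := by
  simp only [gainArgmax, ← level_lt_level_iff, not_lt, Set.mem_ofPred_eq]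

/-- The invariant of General Yankee Swap. -/
structure Invariant (r : Fin n → Finset G → ℕ) (π : Equiv.Perm (Fin n)) (s : State n G) :
    Prop where
  nonRedundant : NonRedundant r s.alloc
  lag : ∀ k, r k (bundle s.alloc (some k)) ≠ 0 → ∀ j ∈ s.active,
    level r π s.alloc k - (n : ℤ) ^ 2 ≤ level r π s.alloc j
  tight : ∀ q : ℤ, ∃ T, IsTight r s.alloc T ∧
    (∀ i, i ∉ s.active → level r π s.alloc i ≤ q → i ∈ T) ∧
    ∀ k ∈ T, r k (bundle s.alloc (some k)) ≠ 0 → level r π s.alloc k - (n : ℤ) ^ 2 ≤ q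

theorem Invariant.init {r : Fin n → Finset G → ℕ} (hr : ∀ i, IsNatRank (r i))
    (π : Equiv.Perm (Fin n)) : Invariant r π (initState n G) := by
  have h : ∀ k, r k (bundle (initState n G).alloc (some k)) = 0 := by
    intro k
    rw [← (hr k).empty]
    congr 1
    ext x
    simp [mem_bundle, initState]
  refine ⟨fun k => ?_, fun k hk => absurd (h k) hk, fun q => ⟨∅, by simp [IsTight], ?_, by simp⟩⟩
  · rw [h k]
    simp [bundle, initState]
  · intro i hi
    simp [initState] at hi

/-- A tight set contains no agent whose utility can grow at nobody's expense. -/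
theorem IsTight.notMem_of_gain {n : ℕ} {G : Type*} [Fintype G]
    {r : Fin n → Finset G → ℕ} {X X' : Allocation n G} {i : Fin n}
    {T : Finset (Fin n)} (hT : IsTight r X T)
    (h : ∀ k, r k (bundle X' (some k)) = r k (bundle X (some k)) + if k = i then 1 else 0) :
    i ∉ T := by
  intro hi
  have := hT X'
  simp only [h, Finset.sum_add_distrib, Finset.sum_ite_eq', hi, if_true] at this
  omega

/-- An agent who has left stays in a tight set, as the `tight` field at the agent's own level shows;
an augmentation would contradict its maximality. -/
theorem Invariant.not_exists_path {r : Fin n → Finset G → ℕ} (hr : ∀ i, IsNatRank (r i))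
    {π : Equiv.Perm (Fin n)} {s : State n G} (hs : Invariant r π s) {i : Fin n}
    (hi : i ∉ s.active) : ¬ ∃ P, IsTransferPath (realVal r) s.alloc i P := by
  intro h
  obtain ⟨P, hP⟩ := exists_shortestTransferPath h
  obtain ⟨T, hT, hiT, -⟩ := hs.tight (level r π s.alloc i)
  exact hT.notMem_of_gain (transfer_shortest hr hs.nonRedundant hP).2 (hiT i hi le_rfl)

/-- An augmentation lifts only a playing agent of lowest level, by `n²`, which preserves `lag`.
Levels never fall, and old tight sets survive because they avoid that agent. A removal needs new
tight sets only for thresholds that reach the level of the leaving agent. -/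
theorem Invariant.step {r : Fin n → Finset G → ℕ} (hr : ∀ i, IsNatRank (r i))
    {π : Equiv.Perm (Fin n)} {s s' : State n G} (hs : Invariant r π s)
    (h : Step (realVal r) (lorenzGain π) s s') : Invariant r π s' := by
  cases h with
  | augment X U i P hi hP =>
    obtain ⟨hiU, hmin⟩ := mem_gainArgmax_iff.1 hi.1
    obtain ⟨h1, h2⟩ := transfer_shortest hr hs.nonRedundant hP
    have hl : ∀ k, level r π (transfer X (some i) P) k =
        level r π X k + if k = i then (n : ℤ) ^ 2 else 0 := by
      intro k
      unfold level
      rw [h2 k]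
      split_ifs <;> push_cast <;> ring
    have hle : ∀ k, level r π X k ≤ level r π (transfer X (some i) P) k := by
      intro k
      rw [hl]
      split_ifs <;> nlinarith
    refine ⟨h1, fun k hk j hj => ?_, fun q => ?_⟩
    · dsimp only at hk hj ⊢
      refine le_trans ?_ (hle j)
      rw [hl]
      by_cases hki : k = i
      · simpa [hki] using hmin j hj
      · rw [h2] at hk
        simp only [hki, if_false, add_zero] at hk ⊢
        exact hs.lag k hk j hj
    · obtain ⟨T, hT, hT1, hT2⟩ := hs.tight q
      dsimp only at hT hT1 hT2 ⊢
      have hiT := hT.notMem_of_gain h2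
      have hne : ∀ k ∈ T, k ≠ i := fun k hk e => hiT (e ▸ hk)
      refine ⟨T, fun Y => ?_, fun j hj hjq => hT1 j hj ((hle j).trans hjq), fun k hk hk0 => ?_⟩
      · refine (hT Y).trans (Finset.sum_le_sum fun k _ => ?_)
        rw [h2]
        exact Nat.le_add_right _ _
      · rw [h2] at hk0
        rw [hl]
        simp only [hne k hk, if_false, add_zero] at hk0 ⊢
        exact hT2 k hk hk0
  | remove X U i hi hP =>
    obtain ⟨hiU, hmin⟩ := mem_gainArgmax_iff.1 hi.1
    refine ⟨hs.nonRedundant, fun k hk j hj => hs.lag k hk j (Finset.mem_of_mem_erase hj),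
      fun q => ?_⟩
    dsimp only
    by_cases hq : level r π X i ≤ q
    -- One tight set contains all agents without a path, including those who left earlier. By `lag`,
    -- its members of nonzero utility are at most `n²` above `i`, hence above `q`.
    · obtain ⟨T, hT, hT1⟩ := exists_isTight hr hs.nonRedundant
      refine ⟨T, hT, fun j hj _ => hT1 j ?_, fun k _ hk0 => (hs.lag k hk0 i hiU).trans hq⟩
      by_cases hji : j = i
      · exact hji ▸ hP
      · exact hs.not_exists_path hr fun hjU => hj (Finset.mem_erase.2 ⟨hji, hjU⟩)
    · obtain ⟨T, hT, hT1, hT2⟩ := hs.tight q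
      refine ⟨T, hT, fun j hj hjq => hT1 j (fun hjU => hj (Finset.mem_erase.2 ⟨?_, hjU⟩)) hjq, hT2⟩
      rintro rfl
      exact hq hjq

theorem Invariant.of_reachable {r : Fin n → Finset G → ℕ} (hr : ∀ i, IsNatRank (r i))
    {π : Equiv.Perm (Fin n)} {s : State n G} (h : Reachable (realVal r) (lorenzGain π) s) :
    Invariant r π s := by
  induction h with
  | refl => exact Invariant.init hr π
  | tail _ hstep ih => exact ih.step hr hstep

/-! ### Termination and progress -/

/-- The number of iterations that may still follow. -/
def potential (r : Fin n → Finset G → ℕ) (s : State n G) : ℕ :=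
  Fintype.card G - ∑ k, r k (bundle s.alloc (some k)) + s.active.card

theorem Invariant.potential_lt {r : Fin n → Finset G → ℕ} (hr : ∀ i, IsNatRank (r i))
    {π : Equiv.Perm (Fin n)} {s s' : State n G} (hs : Invariant r π s)
    (h : Step (realVal r) (lorenzGain π) s s') : potential r s' < potential r s := by
  cases h with
  | augment X U i P hi hP =>
    obtain ⟨h1, h2⟩ := transfer_shortest hr hs.nonRedundant hP
    -- This bound keeps the truncated subtraction in `potential` from hiding the decrease.
    have hle : ∑ k, r k (bundle (transfer X (some i) P) (some k)) ≤ Fintype.card G := by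
      refine le_trans (le_of_eq ?_)
        (sum_card_bundle_inter_le (transfer X (some i) P) Finset.univ Finset.univ)
      simp [h1 _]
    have hsum : ∑ k, r k (bundle (transfer X (some i) P) (some k)) =
        ∑ k, r k (bundle X (some k)) + 1 := by
      simp [h2, Finset.sum_add_distrib]
    simp only [potential]
    omega
  | remove X U i hi hP =>
    have := Finset.card_erase_lt_of_mem hi.1.1
    simp only [potential]
    omega

theorem exists_step (r : Fin n → Finset G → ℕ) (π : Equiv.Perm (Fin n)) {s : State n G}
    (hs : s.active ≠ ∅) : ∃ s', Step (realVal r) (lorenzGain π) s s' := by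
  obtain ⟨X, U⟩ := s
  obtain ⟨i, hiU, hmin⟩ := Finset.exists_min_image U (level r π X)
    (Finset.nonempty_iff_ne_empty.2 hs)
  have hne : (gainArgmax (lorenzGain π) (utility (realVal r) X) U).Nonempty :=
    ⟨i, mem_gainArgmax_iff.2 ⟨hiU, hmin⟩⟩
  obtain ⟨j, hj, hjmin⟩ := WellFounded.has_min (wellFounded_lt (α := Fin n)) _ hne
  have hleast : IsLeast (gainArgmax (lorenzGain π) (utility (realVal r) X) U) j :=
    ⟨hj, fun k hk => not_lt.1 (hjmin k hk)⟩
  by_cases hP : ∃ P, IsTransferPath (realVal r) X j P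
  · obtain ⟨P, hP⟩ := exists_shortestTransferPath hP
    exact ⟨_, Step.augment X U j P hleast hP⟩
  · exact ⟨_, Step.remove X U j hleast hP⟩

/-! ### Optimality -/

/-- The bound on the gain of one agent in terms of the tight sets that contain the agent. -/
theorem min_sub_min_le {M p a b t : ℤ} (hM : 0 ≤ M) (ha : 0 ≤ a) (hb : 0 ≤ b) {S : ℤ → Prop}
    [DecidablePred S] (h1 : ∀ q, M * a + p ≤ q → S q)
    (h2 : ∀ q, S q → a ≠ 0 → M * a + p - M ≤ q) :
    min (M * b + p) t - min (M * a + p) t ≤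
      ∑ q ∈ Finset.Ico (t - M) t, if S q then b - a else 0 := by
  rw [← Finset.sum_filter, Finset.sum_const, nsmul_eq_mul]
  set c := (Finset.Ico (t - M) t |>.filter S).card with hc
  rcases lt_trichotomy a b with hab | hab | hab
  -- All thresholds of the window from the level `M * a + p` on are counted. If that level is below
  -- `t`, there are at least `min M (t - level)` of them, while the truncated gain is at most `min
  -- (M * d) (t - level)`, where `d = b - a`.
  · have hsub : Finset.Ico (max (t - M) (M * a + p)) t ⊆ (Finset.Ico (t - M) t).filter S := by
      intro q hq
      simp only [Finset.mem_Ico, Finset.mem_filter, max_le_iff] at hq ⊢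
      exact ⟨⟨hq.1.1, hq.2⟩, h1 q hq.1.2⟩
    have hcard := Finset.card_le_card hsub
    rw [Int.card_Ico, ← hc] at hcard
    have hcard' : t - max (t - M) (M * a + p) ≤ c := by omega
    have hc0 : (0 : ℤ) ≤ c := by positivity
    obtain ⟨d, rfl⟩ : ∃ d, b = a + d := ⟨b - a, by ring⟩
    have hd : 1 ≤ d := by linarith
    have hcd : (c : ℤ) ≤ c * d := le_mul_of_one_le_right hc0 hd
    have e : M * (a + d) + p = M * a + p + M * d := by ring
    rw [e, add_sub_cancel_left]
    set w := M * a + p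
    rcases le_total (t - M) w with hw | hw
    · rw [max_eq_right hw] at hcard'
      have : min (w + M * d) t ≤ t := min_le_right _ _
      rcases le_total w t with h | h
      · rw [min_eq_left h]; linarith
      · rw [min_eq_right h]; linarith [mul_nonneg hc0 (by linarith : (0 : ℤ) ≤ d)]
    · rw [max_eq_left hw] at hcard'
      have h3 : min (w + M * d) t ≤ w + M * d := min_le_left _ _
      have h4 : M * d ≤ c * d := mul_le_mul_of_nonneg_right (by linarith) (by linarith)
      rw [min_eq_left (by linarith : w ≤ t)]
      linarith
  · subst hab; simp
  · have ha0 : a ≠ 0 := by omega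
    -- Now `a > b`, and too many counted thresholds would do harm. None lies more than `M` below the
    -- level of `a`, which caps their number by what the truncated loss can pay for.
    have hsub : (Finset.Ico (t - M) t).filter S ⊆ Finset.Ico (max (t - M) (M * a + p - M)) t := by
      intro q hq
      simp only [Finset.mem_Ico, Finset.mem_filter, max_le_iff] at hq ⊢
      exact ⟨⟨hq.1.1, h2 q hq.2 ha0⟩, hq.1.2⟩
    have hcard := Finset.card_le_card hsub
    rw [Int.card_Ico, ← hc] at hcard
    have hc0 : (0 : ℤ) ≤ c := by positivity
    obtain ⟨e, rfl⟩ : ∃ e, a = b + e := ⟨a - b, by ring⟩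
    have he : 1 ≤ e := by linarith
    have e1 : M * b + p = M * (b + e) + p - M * e := by ring
    have e2 : (c : ℤ) * (b - (b + e)) = -(c * e) := by ring
    rw [e1, e2]
    set w := M * (b + e) + p
    have hMe : M ≤ M * e := le_mul_of_one_le_right hM he
    rcases le_total t (w - M) with hw | hw
    · have : (c : ℤ) = 0 := by
        have := le_max_right (t - M) (w - M)
        omega
      rw [this, min_eq_right (by linarith : t ≤ w)]
      have := min_le_right (w - M * e) t
      linarith
    · have hcM : (c : ℤ) ≤ M := by
        have := le_max_left (t - M) (w - M)
        omega
      have hcw : (c : ℤ) ≤ t - (w - M) := by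
        have := le_max_right (t - M) (w - M)
        omega
      have h3 := min_le_left (w - M * e) t
      rcases le_total w t with h | h
      · rw [min_eq_left h]
        have : (c : ℤ) * e ≤ M * e := mul_le_mul_of_nonneg_right hcM (by linarith)
        linarith
      · rw [min_eq_right h]
        -- Here the loss is at least `t - w + M * e = (t - w + M) + M * (e - 1)`, and `c` is at most
        -- both `t - w + M` and `M`.
        have h4 : (M - c) * 1 ≤ (M - c) * e := mul_le_mul_of_nonneg_left he (by linarith)
        nlinarith

/-- Summing `min_sub_min_le` over the agents and exchanging the two sums leaves, for each threshold
`q`, the change in total utility on the tight set `T q`, which is never positive. Since nobody is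
playing, the sets `T q` contain every agent of level at most `q`. -/
theorem Invariant.sum_min_level_le {n : ℕ} {G : Type*} [Fintype G]
    {r : Fin n → Finset G → ℕ} {π : Equiv.Perm (Fin n)}
    {s : State n G} (hs : Invariant r π s) (h : s.active = ∅) (Y : Allocation n G) (t : ℤ) :
    ∑ k, min (level r π Y k) t ≤ ∑ k, min (level r π s.alloc k) t := by
  choose T hT hT1 hT2 using hs.tight
  have key : ∀ k, min (level r π Y k) t - min (level r π s.alloc k) t ≤
      ∑ q ∈ Finset.Ico (t - (n : ℤ) ^ 2) t, if k ∈ T q then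
        (r k (bundle Y (some k)) : ℤ) - r k (bundle s.alloc (some k)) else 0 := by
    intro k
    refine min_sub_min_le (S := fun q => k ∈ T q) (by positivity) (by positivity) (by positivity)
      (fun q hq => hT1 q k (by simp [h]) hq) fun q hq h0 => hT2 q k hq ?_
    exact_mod_cast h0
  have hsum := Finset.sum_le_sum fun k (_ : k ∈ Finset.univ) => key k
  rw [Finset.sum_sub_distrib, Finset.sum_comm] at hsum
  refine sub_nonpos.1 (hsum.trans (Finset.sum_nonpos fun q _ => ?_))
  rw [← Finset.sum_filter, Finset.filter_univ_mem, Finset.sum_sub_distrib, sub_nonpos]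
  exact_mod_cast hT q Y

theorem utility_perturbed {n : ℕ} {G : Type*} [Fintype G]
    (r : Fin n → Finset G → ℕ) (π : Equiv.Perm (Fin n))
    (X : Allocation n G) (i : Fin n) :
    utility (perturbed (realVal r) π) X i = (level r π X i : ℝ) / (n : ℝ) ^ 2 := by
  have hn : (n : ℝ) ≠ 0 := by
    have := i.pos
    positivity
  simp only [utility, perturbed, priority, level]
  push_cast
  field_simp

theorem Invariant.isPrioritizedLorenzDominating {n : ℕ} {G : Type*} [Fintype G]
    {r : Fin n → Finset G → ℕ}
    {π : Equiv.Perm (Fin n)} {s : State n G} (hs : Invariant r π s) (h : s.active = ∅) :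
    IsPrioritizedLorenzDominating (realVal r) π s.alloc := by
  intro Y k h1 hk
  refine sumSmallest_le_of_sum_min_le (fun i => ?_) h1 hk
  simp only [utility_perturbed]
  have hn : (0 : ℝ) ≤ (n : ℝ) ^ 2 := by positivity
  simp only [min_div_div_right hn, ← Finset.sum_div]
  refine div_le_div_of_nonneg_right ?_ hn
  exact_mod_cast hs.sum_min_level_le h Y (level r π Y i)

theorem computes_isPrioritizedLorenzDominating {r : Fin n → Finset G → ℕ}
    (hr : ∀ i, IsNatRank (r i)) (π : Equiv.Perm (Fin n)) :
    Computes (realVal r) (lorenzGain π) (IsPrioritizedLorenzDominating (realVal r) π) := by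
  refine ⟨?_, fun s _ hs => exists_step r π hs, fun s hs h =>
    (Invariant.of_reachable hr hs).isPrioritizedLorenzDominating h⟩
  rintro ⟨f, hf0, hf⟩
  have hinv : ∀ t, Invariant r π (f t) := by
    intro t
    induction t with
    | zero => exact hf0 ▸ Invariant.init hr π
    | succ t ih => exact ih.step hr (hf t)
  have hlt : ∀ t, potential r (f t) + t ≤ potential r (f 0) := by
    intro t
    induction t with
    | zero => simp
    | succ t ih =>
      have := (hinv t).potential_lt hr (hf t)
      omega
  have := hlt (potential r (f 0) + 1)
  omega

end YankeeSwap

theorem mainTheorem9 {n : ℕ} {G : Type*} [Fintype G] [DecidableEq G]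
    (v : Fin n → Finset G → ℝ) (hv : ∀ i, YankeeSwap.IsMRF (v i)) (π : Equiv.Perm (Fin n)) :
    YankeeSwap.Computes v (YankeeSwap.lorenzGain π)
      (YankeeSwap.IsPrioritizedLorenzDominating v π) := by
  choose r hr hvr using fun i => (hv i).exists_natRank
  obtain rfl : v = YankeeSwap.realVal r := funext fun i => funext fun S => hvr i S
  exact YankeeSwap.computes_isPrioritizedLorenzDominating hr π
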